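/- For $n\ge 0$ let $\mathfrak S_n$ be the set of permutations of $\{1,\dots,n\}$. For $\pi\in\mathfrak S_n$ let $\mathrm{fp}(\pi)=|\{i:\pi_i=i\}|$ be its number of fixed points and $\mathrm{exc}(\pi)=|\{i:\pi_i>i\}|$ its number of excedances. A permutation $\pi$ avoids a pattern $\sigma\in\mathfrak S_m$ if it has no subsequence of length $m$ in the same relative order as $\sigma$; for a set $\Sigma$ of patterns, $\mathfrak S_n(\Sigma)$ is the set of $\pi\in\mathfrak S_n$ avoiding every pattern in $\Sigma$. Define the generating function $$F_\Sigma(x,q,z)=\sum_{n\ge0}\ \sum_{\pi\in\mathfrak S_n(\Sigma)}x^{\mathrm{fp}(\pi)}q^{\mathrm{exc}(\pi)}z^n\in\mathbb Z[x,q][[z]].$$ For $i,h\ge0$ let $\mathbf C_i^{\le h}$ be the number of Dyck paths of length $2i$ (lattice paths from $(0,0)$ to $(2i,0)$ with steps $(1,1)$ and $(1,-1)$ never going below the $x$-axis) whose height (largest $y$-coordinate) is at most $h$, and let $\mathbf C_{<i}^{\le h}(z)=\sum_{j=0}^{i-1}\mathbf C_j^{\le h}z^j$. **Theorem.** For every $k\ge0$,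 $$F_{\{312,\,(k+1)k\cdots 1\}}(x,q,z)=A_0^k(x,q,z),$$ where, for $0\le i\le k$, the formal power series $A_i^k(x,q,z)\in\mathbb Z[x,q][[z]]$ is defined recursively by $A_k^k(x,q,z)=1$ and, for $i<k$, $$A_i^k(x,q,z)=\frac{1}{1-z\left[(x-1)\,\mathbf C_i^{\le k-i-1}q^iz^i+(q-1)\,\mathbf C_{<i}^{\le k-i-1}(qz)+A_{i+1}^k(x,q,z)\right]}.$$ -/

import Mathlib

namespace PatternFPExc

open PowerSeries

/-! ### Pattern avoidance and the generating function of fixed points and excedances -/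

/-- A pattern: a permutation of `{0, …, m-1}` for some `m`. -/
abbrev Pattern : Type := (m : ℕ) × Equiv.Perm (Fin m)

/-- `π` contains `σ`: there are positions `f 0 < f 1 < ⋯ < f (m-1)` such that the corresponding
subsequence of `π` is in the same relative order as `σ`. -/
def Contains {n : ℕ} (π : Equiv.Perm (Fin n)) (σ : Pattern) : Prop :=
  ∃ f : Fin σ.1 ↪o Fin n, ∀ a b : Fin σ.1, π (f a) < π (f b) ↔ σ.2 a < σ.2 b

/-- `π` avoids all the patterns in `S`. -/
def Avoids {n : ℕ} (π : Equiv.Perm (Fin n)) (S : Set Pattern) : Prop :=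
  ∀ σ ∈ S, ¬ Contains π σ

/-- The number of fixed points of `π`. -/
def fp {n : ℕ} (π : Equiv.Perm (Fin n)) : ℕ :=
  (Finset.univ.filter fun i => π i = i).card

/-- The number of excedances of `π`. -/
def exc {n : ℕ} (π : Equiv.Perm (Fin n)) : ℕ :=
  (Finset.univ.filter fun i => i < π i).card

/-- The polynomial ring `ℤ[x, q]`. Generating functions live in `ℤ[x, q]⟦z⟧`. -/
abbrev Coeffs : Type := MvPolynomial (Fin 2) ℤ

/-- The variable `x`, marking fixed points. -/
noncomputable def x : Coeffs := MvPolynomial.X 0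

/-- The variable `q`, marking excedances. -/
noncomputable def q : Coeffs := MvPolynomial.X 1

/-- The variable `z`, marking length. -/
noncomputable def z : Coeffs⟦X⟧ := PowerSeries.X

open Classical in
/-- `F_S(x, q, z) = ∑_{n ≥ 0} ∑_{π ∈ 𝔖_n(S)} x^{fp π} q^{exc π} z^n`. -/
noncomputable def F (S : Set Pattern) : Coeffs⟦X⟧ :=
  PowerSeries.mk fun n =>
    ∑ π : Equiv.Perm (Fin n) with Avoids π S, x ^ fp π * q ^ exc π

/-- The pattern `312`, written with the values `0, 1, 2`. -/
def pattern312 : Pattern :=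
  ⟨3, { toFun := ![2, 0, 1]
        invFun := ![1, 2, 0]
        left_inv := by decide
        right_inv := by decide }⟩

/-- The decreasing pattern `m (m-1) ⋯ 2 1` of length `m`. -/
def decreasing (m : ℕ) : Pattern := ⟨m, Fin.revPerm⟩

/-! ### Dyck paths of bounded height -/

/-- The height of a Dyck path: the largest `y`-coordinate of one of its points. -/
def height (p : DyckWord) : ℕ :=
  (Finset.range (p.toList.length + 1)).sup fun i =>
    (p.toList.take i).count DyckStep.U - (p.toList.take i).count DyckStep.D

/-- `C_i^{≤ h}`: the number of Dyck paths of length `2 i` and height at most `h`. -/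
noncomputable def boundedDyck (i h : ℕ) : ℕ :=
  Nat.card {p : DyckWord // p.semilength = i ∧ height p ≤ h}

/-- The set counted by `boundedDyck` is finite, so that the cardinality is the true one. -/
theorem finite_boundedDyck (i h : ℕ) :
    Finite {p : DyckWord // p.semilength = i ∧ height p ≤ h} :=
  Finite.of_injective
    (fun p => (⟨p.1, p.2.1⟩ : {p : DyckWord // p.semilength = i}))
    (fun _ _ hab => Subtype.ext (congrArg (fun r => r.1) hab))

/-- `C_{<i}^{≤ h}(t) = ∑_{j < i} C_j^{≤ h} t^j`. -/
noncomputable def truncDyck (i h : ℕ) (t : Coeffs⟦X⟧) : Coeffs⟦X⟧ :=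
  ∑ j ∈ Finset.range i, (boundedDyck j h : Coeffs⟦X⟧) * t ^ j

/-! ### The finite continued fraction -/

/-- `1 / (1 - z B)`: the inverse of `1 - z B` in `ℤ[x, q]⟦z⟧`, which exists because the constant
term of `1 - z B` is `1`. -/
noncomputable def oneDivOneSubZMul (B : Coeffs⟦X⟧) : Coeffs⟦X⟧ :=
  PowerSeries.invOfUnit (1 - z * B) 1

theorem oneSubZMul_mul_oneDiv (B : Coeffs⟦X⟧) :
    (1 - z * B) * oneDivOneSubZMul B = 1 :=
  PowerSeries.mul_invOfUnit _ _ (by simp [z])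

/-- The series `A_i^k` for `0 ≤ i ≤ k` (it also takes the value `1`, never used, for `i > k`). -/
noncomputable def A (k i : ℕ) : Coeffs⟦X⟧ :=
  if i < k then
    oneDivOneSubZMul
      ((C x - 1) * (boundedDyck i (k - i - 1) : Coeffs⟦X⟧) * C q ^ i * z ^ i
        + (C q - 1) * truncDyck i (k - i - 1) (C q * z)
        + A k (i + 1))
  else 1
termination_by k - i

end PatternFPExc

namespace PatternFPExc

open PowerSeries

/-! ### The first-return recursion for Dyck paths of bounded height -/

/-! Fixed points and excedances do not restrict well to blocks, so the statement is generalised: all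
values are raised by `i` before being compared with their positions. In a `312`-avoiding permutation
with `0` at position `a`, every entry left of `0` is below every entry right of it, so the word is
`(σ + 1) 0 (τ + a + 1)` (`exists_eq_glue`). The left block gains one in value but not in position,
so its raise becomes `i + 1`; since `0` extends its decreasing subsequences, its bound on them drops
by one. The right block keeps both parameters. This gives the recursion `weightSum_succ`, hence `1 /
(1 - z B)` in `mk_weightSum_eq`.

In `B` the entry `0` weighs `q`, `x` or `1` as `a < i`, `a = i` or `a > i`. Starting from weight `1`
throughout, which gives `A_{i+1}`, only the terms with `a ≤ i` need correcting. There the left block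
is no longer than its raise, so all its entries are excedances, and its enumerator is `q ^ a` times
a count obeying the first-return recursion of Dyck paths of bounded height (`weightSum_of_le`). -/

theorem height_le_iff (p : DyckWord) (h : ℕ) :
    height p ≤ h ↔
      ∀ i, (p.toList.take i).count DyckStep.U ≤ (p.toList.take i).count DyckStep.D + h := by
  unfold height
  rw [Finset.sup_le_iff]
  constructor
  · intro H i
    -- Prefixes longer than the word equal the whole word, so the range of `i` may be unbounded.
    have := H (min i p.toList.length) (by simp)
    rwa [← List.take_eq_take_min, tsub_le_iff_left] at this
  · intro H i _
    have := H i
    omega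

theorem height_zero_le (h : ℕ) : height 0 ≤ h := by
  rw [height_le_iff]
  intro i
  simp [show (0 : DyckWord).toList = [] from rfl]

theorem height_add_le_iff (p r : DyckWord) (h : ℕ) :
    height (p + r) ≤ h ↔ height p ≤ h ∧ height r ≤ h := by
  simp only [height_le_iff, show (p + r).toList = p.toList ++ r.toList from rfl,
    List.take_append, List.count_append]
  have hp := p.count_U_eq_count_D
  refine ⟨fun H => ⟨fun i => ?_, fun i => ?_⟩, fun ⟨H₁, H₂⟩ i => ?_⟩
  · rcases le_total i p.toList.length with hi | hi
    · simpa [Nat.sub_eq_zero_of_le hi] using H i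
    · rw [List.take_of_length_le hi]
      omega
  · have := H (p.toList.length + i)
    rw [List.take_of_length_le (Nat.le_add_right _ _), Nat.add_sub_cancel_left] at this
    omega
  · rcases le_total i p.toList.length with hi | hi
    · simpa [Nat.sub_eq_zero_of_le hi] using H₁ i
    · rw [List.take_of_length_le hi]
      have := H₂ (i - p.toList.length)
      omega

theorem toList_nest (p : DyckWord) :
    p.nest.toList = DyckStep.U :: (p.toList ++ [DyckStep.D]) := rfl

theorem height_nest_le_succ_iff (p : DyckWord) (h : ℕ) :
    height p.nest ≤ h + 1 ↔ height p ≤ h := by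
  simp only [height_le_iff, toList_nest]
  have hp := p.count_U_eq_count_D
  constructor
  · intro H i
    rcases le_total i p.toList.length with hi | hi
    · have := H (i + 1)
      simp [List.take_append, Nat.sub_eq_zero_of_le hi] at this
      omega
    · rw [List.take_of_length_le hi]
      omega
  · intro H i
    rcases i with _ | i
    · simp
    · have h1 := H i
      have h2 : ([DyckStep.D].take (i - p.toList.length)).count DyckStep.U = 0 := by
        rw [List.count_eq_zero]
        intro hm
        simpa using List.mem_of_mem_take hm
      simp only [List.take_succ_cons, List.take_append, List.count_cons, List.count_append, h2]
      simp
      omega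

theorem not_height_nest_le_zero (p : DyckWord) : ¬ height p.nest ≤ 0 := by
  rw [height_le_iff, toList_nest]
  intro H
  simpa using H 1

theorem boundedDyck_zero (h : ℕ) : boundedDyck 0 h = 1 := by
  unfold boundedDyck
  rw [Nat.card_eq_one_iff_unique]
  refine ⟨⟨fun p r => ?_⟩, ⟨0, rfl, height_zero_le h⟩⟩
  have key : ∀ p : DyckWord, p.semilength = 0 → p = 0 := by
    intro p hp
    by_contra h0
    have := DyckWord.semilength_insidePart_add_semilength_outsidePart_add_one h0
    omega
  exact Subtype.ext ((key _ p.2.1).trans (key _ r.2.1).symm)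

theorem boundedDyck_succ_zero (n : ℕ) : boundedDyck (n + 1) 0 = 0 := by
  unfold boundedDyck
  rw [Nat.card_eq_zero]
  refine Or.inl ⟨fun ⟨p, hp, hh⟩ => ?_⟩
  have h0 : p ≠ 0 := by
    rintro rfl
    simp at hp
  rw [← DyckWord.nest_insidePart_add_outsidePart h0, height_add_le_iff] at hh
  exact not_height_nest_le_zero _ hh.1

/-- The decomposition of a nonempty Dyck path of bounded height at its first return. -/
def firstReturnEquiv (n h : ℕ) :
    {p : DyckWord // p.semilength = n + 1 ∧ height p ≤ h + 1} ≃
      Σ ab : Finset.HasAntidiagonal.antidiagonal n,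
        {p : DyckWord // p.semilength = ab.1.1 ∧ height p ≤ h} ×
          {p : DyckWord // p.semilength = ab.1.2 ∧ height p ≤ h + 1} where
  toFun p :=
    have h0 : p.1 ≠ 0 := by
      rintro h0
      simpa [h0] using p.2.1
    have hs := DyckWord.semilength_insidePart_add_semilength_outsidePart_add_one h0
    have hh : height p.1.insidePart.nest ≤ h + 1 ∧ height p.1.outsidePart ≤ h + 1 := by
      rw [← height_add_le_iff, DyckWord.nest_insidePart_add_outsidePart h0]
      exact p.2.2
    ⟨⟨(p.1.insidePart.semilength, p.1.outsidePart.semilength), by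
        rw [Finset.HasAntidiagonal.mem_antidiagonal]
        have := p.2.1
        omega⟩,
      ⟨p.1.insidePart, rfl, (height_nest_le_succ_iff _ _).1 hh.1⟩,
      ⟨p.1.outsidePart, rfl, hh.2⟩⟩
  invFun s := ⟨s.2.1.1.nest + s.2.2.1, by
      have := Finset.HasAntidiagonal.mem_antidiagonal.1 s.1.2
      rw [DyckWord.semilength_add, DyckWord.semilength_nest, s.2.1.2.1, s.2.2.2.1]
      omega, (height_add_le_iff _ _ _).2
        ⟨(height_nest_le_succ_iff _ _).2 s.2.1.2.2, s.2.2.2.2⟩⟩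
  left_inv p := by
    have h0 : p.1 ≠ 0 := by
      rintro h0
      simpa [h0] using p.2.1
    exact Subtype.ext (DyckWord.nest_insidePart_add_outsidePart h0)
  right_inv := by
    rintro ⟨⟨⟨a, b⟩, hab⟩, ⟨p, hp, hp'⟩, ⟨r, hr, hr'⟩⟩
    obtain rfl : p.semilength = a := hp
    obtain rfl : r.semilength = b := hr
    have h1 : (p.nest + r).insidePart = p := by simp
    have h2 : (p.nest + r).outsidePart = r := by simp
    simp only
    congr!

/-- The part inside the first arch is lifted by one level and so has one level less available; the
part after the return keeps the full bound. -/
theorem boundedDyck_succ_succ (n h : ℕ) :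
    boundedDyck (n + 1) (h + 1) =
      ∑ ab ∈ Finset.HasAntidiagonal.antidiagonal n, boundedDyck ab.1 h * boundedDyck ab.2 (h + 1) := by
  have := finite_boundedDyck
  rw [← Finset.sum_coe_sort]
  unfold boundedDyck
  rw [Nat.card_congr (firstReturnEquiv n h), Nat.card_sigma]
  exact Finset.sum_congr rfl fun _ _ => Nat.card_prod _ _

/-! ### Avoidance in terms of positions -/

theorem contains_pattern312_iff {n : ℕ} (π : Equiv.Perm (Fin n)) :
    Contains π pattern312 ↔ ∃ i j k, i < j ∧ j < k ∧ π j < π k ∧ π k < π i := by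
  constructor
  · rintro ⟨f, hf⟩
    refine ⟨f (0 : Fin 3), f (1 : Fin 3), f (2 : Fin 3), f.strictMono (by decide : (0 : Fin 3) < 1),
      f.strictMono (by decide : (1 : Fin 3) < 2), (hf (1 : Fin 3) (2 : Fin 3)).2 ?_,
      (hf (2 : Fin 3) (0 : Fin 3)).2 ?_⟩
    · change (0 : Fin 3) < 1
      decide
    · change (1 : Fin 3) < 2
      decide
  · rintro ⟨i, j, k, hij, hjk, h1, h2⟩
    have hmono : StrictMono (![i, j, k] : Fin 3 → Fin n) := by
      rw [Fin.strictMono_iff_lt_succ]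
      intro t
      fin_cases t
      · exact hij
      · exact hjk
    have horder : ∀ s t : Fin 3, π ((![i, j, k] : Fin 3 → Fin n) s) <
        π ((![i, j, k] : Fin 3 → Fin n) t) ↔
        (![2, 0, 1] : Fin 3 → Fin 3) s < (![2, 0, 1] : Fin 3 → Fin 3) t := by
      intro s t
      have h3 := h1.trans h2
      fin_cases s <;> fin_cases t <;> simp [h1, h2, h3, h1.le, h2.le, h3.le]
    exact ⟨OrderEmbedding.ofStrictMono _ hmono, horder⟩

theorem contains_decreasing_iff {n : ℕ} (π : Equiv.Perm (Fin n)) (m : ℕ) :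
    Contains π (decreasing m) ↔
      ∃ f : Fin m → Fin n, StrictMono f ∧ StrictAnti fun t => π (f t) := by
  constructor
  · rintro ⟨f, hf⟩
    refine ⟨f, f.strictMono, fun s t hst => (hf t s).2 ?_⟩
    exact Fin.rev_lt_rev.2 hst
  · rintro ⟨f, hf, hf'⟩
    refine ⟨OrderEmbedding.ofStrictMono f hf, fun s t => ?_⟩
    exact (hf'.lt_iff_gt (a := s) (b := t)).trans Fin.rev_lt_rev.symm

theorem avoids_pair_iff {n : ℕ} (π : Equiv.Perm (Fin n)) (m : ℕ) :
    Avoids π {pattern312, decreasing m} ↔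
      ¬ Contains π pattern312 ∧ ¬ Contains π (decreasing m) := by
  simp [Avoids]

/-! ### Decomposition of `312`-avoiding permutations at their smallest value -/

section Glue

variable {a b : ℕ}

/-- The word of `(σ + 1) 0 (τ + a + 1)`. -/
def glueFun (σ : Equiv.Perm (Fin a)) (τ : Equiv.Perm (Fin b)) :
    Fin (a + (b + 1)) → Fin (a + (b + 1)) :=
  Fin.addCases (fun p => ⟨σ p + 1, by omega⟩)
    (Fin.cases ⟨0, by omega⟩ fun r => Fin.natAdd a (τ r).succ)

theorem exists_position (p : Fin (a + (b + 1))) :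
    (∃ l, p = Fin.castAdd (b + 1) l) ∨ p = Fin.natAdd a 0 ∨
      ∃ r : Fin b, p = Fin.natAdd a r.succ := by
  refine Fin.addCases (fun l => Or.inl ⟨l, rfl⟩) (fun t => Or.inr ?_) p
  exact Fin.cases (Or.inl rfl) (fun r => Or.inr ⟨r, rfl⟩) t

variable (σ σ' : Equiv.Perm (Fin a)) (τ τ' : Equiv.Perm (Fin b))

theorem glueFun_left (l : Fin a) : (glueFun σ τ (Fin.castAdd (b + 1) l) : ℕ) = σ l + 1 := by
  simp [glueFun]

theorem glueFun_mid : (glueFun σ τ (Fin.natAdd a 0) : ℕ) = 0 := by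
  simp [glueFun]

theorem glueFun_right (r : Fin b) :
    (glueFun σ τ (Fin.natAdd a r.succ) : ℕ) = a + 1 + τ r := by
  simp [glueFun]
  omega

theorem glueFun_injective : Function.Injective (glueFun σ τ) := by
  intro p p' h
  replace h := congrArg Fin.val h
  rcases exists_position p with ⟨l, rfl⟩ | rfl | ⟨r, rfl⟩ <;>
    rcases exists_position p' with ⟨l', rfl⟩ | rfl | ⟨r', rfl⟩ <;>
    simp only [glueFun_left, glueFun_mid, glueFun_right] at h <;>
    first
    | rfl
    | (exfalso; omega)
    | skip
  · rw [σ.injective (Fin.ext (by omega : (σ l : ℕ) = σ l'))]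
  · rw [τ.injective (Fin.ext (by omega : (τ r : ℕ) = τ r'))]

/-- The permutation `(σ + 1) 0 (τ + a + 1)`. -/
noncomputable def glue : Equiv.Perm (Fin (a + (b + 1))) :=
  Equiv.ofBijective (glueFun σ τ) (Finite.injective_iff_bijective.1 (glueFun_injective σ τ))

theorem glue_left (l : Fin a) : (glue σ τ (Fin.castAdd (b + 1) l) : ℕ) = σ l + 1 :=
  glueFun_left σ τ l

theorem glue_mid : (glue σ τ (Fin.natAdd a 0) : ℕ) = 0 := glueFun_mid σ τ

theorem glue_right (r : Fin b) : (glue σ τ (Fin.natAdd a r.succ) : ℕ) = a + 1 + τ r :=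
  glueFun_right σ τ r

variable {σ σ' τ τ'} in
theorem glue_injective (h : glue σ τ = glue σ' τ') : σ = σ' ∧ τ = τ' := by
  constructor
  · ext l
    have := glue_left σ τ l
    rw [h, glue_left] at this
    omega
  · ext r
    have := glue_right σ τ r
    rw [h, glue_right] at this
    omega

/-- The first and last entries of a `312` form an inversion enclosing a smaller entry. Inversions
occur only within a block or between the left block and `0`; the latter enclose only positive
values. -/
theorem contains_pattern312_glue :
    Contains (glue σ τ) pattern312 ↔ Contains σ pattern312 ∨ Contains τ pattern312 := by
  simp only [contains_pattern312_iff]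
  constructor
  · rintro ⟨i, j, k, h1, h2, h3, h4⟩
    rw [Fin.lt_def] at h1 h2 h3 h4
    rcases exists_position i with ⟨i, rfl⟩ | rfl | ⟨i, rfl⟩ <;>
      rcases exists_position j with ⟨j, rfl⟩ | rfl | ⟨j, rfl⟩ <;>
      rcases exists_position k with ⟨k, rfl⟩ | rfl | ⟨k, rfl⟩ <;>
      simp only [glue_left, glue_mid, glue_right, Fin.val_castAdd, Fin.val_natAdd, Fin.val_succ,
        Fin.val_zero] at h1 h2 h3 h4 <;>
      first
      | (exfalso; omega)
      | skip
    · exact Or.inl ⟨i, j, k, by simp only [Fin.lt_def]; omega⟩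
    · exact Or.inr ⟨i, j, k, by simp only [Fin.lt_def]; omega⟩
  · rintro (⟨i, j, k, h⟩ | ⟨i, j, k, h⟩)
    · refine ⟨Fin.castAdd _ i, Fin.castAdd _ j, Fin.castAdd _ k, ?_⟩
      simp only [Fin.lt_def, glue_left, Fin.val_castAdd] at h ⊢
      omega
    · refine ⟨Fin.natAdd _ i.succ, Fin.natAdd _ j.succ, Fin.natAdd _ k.succ, ?_⟩
      simp only [Fin.lt_def, glue_right, Fin.val_natAdd, Fin.val_succ] at h ⊢
      omega

theorem contains_decreasing_glue (m : ℕ) :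
    Contains (glue σ τ) (decreasing (m + 1)) ↔
      Contains σ (decreasing m) ∨ Contains τ (decreasing (m + 1)) := by
  simp only [contains_decreasing_iff]
  constructor
  · rintro ⟨f, hf, hf'⟩
    -- If the subsequence ends at or before `0`, its first `m` terms lie in the left block.
    -- Otherwise it ends in the right block, whose values exceed all others, so it lies there
    -- entirely.
    by_cases hl : (f (Fin.last m) : ℕ) ≤ a
    · left
      have key : ∀ t : Fin m, ∃ l, f t.castSucc = Fin.castAdd (b + 1) l := by
        intro t
        have ht : f t.castSucc < f (Fin.last m) := hf (Fin.castSucc_lt_last t)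
        rw [Fin.lt_def] at ht
        exact ⟨⟨f t.castSucc, by omega⟩, rfl⟩
      choose g hg using key
      refine ⟨g, fun s t hst => ?_, fun s t hst => ?_⟩
      · have := hf (Fin.castSucc_lt_castSucc_iff.2 hst)
        rw [hg, hg, Fin.lt_def] at this
        exact this
      · have := hf' (Fin.castSucc_lt_castSucc_iff.2 hst)
        simp only [hg, Fin.lt_def, glue_left] at this ⊢
        omega
    · right
      have key : ∀ t : Fin (m + 1), ∃ r : Fin b, f t = Fin.natAdd a r.succ := by
        intro t
        have ht : glue σ τ (f (Fin.last m)) ≤ glue σ τ (f t) := hf'.antitone (Fin.le_last t)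
        rw [Fin.le_def] at ht
        have h1 : a + 1 ≤ (glue σ τ (f (Fin.last m)) : ℕ) := by
          rcases exists_position (f (Fin.last m)) with ⟨l, h⟩ | h | ⟨r, h⟩
          · rw [h, Fin.val_castAdd] at hl
            omega
          · rw [h, Fin.val_natAdd, Fin.val_zero] at hl
            omega
          · rw [h, glue_right]
            omega
        rcases exists_position (f t) with ⟨l, h⟩ | h | h
        · rw [h, glue_left] at ht
          omega
        · rw [h, glue_mid] at ht
          omega
        · exact h
      choose g hg using key
      refine ⟨g, fun s t hst => ?_, fun s t hst => ?_⟩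
      · have := hf hst
        simp only [hg, Fin.lt_def, Fin.val_natAdd, Fin.val_succ] at this ⊢
        omega
      · have := hf' hst
        simp only [hg, Fin.lt_def, glue_right] at this ⊢
        omega
  · rintro (⟨f, hf, hf'⟩ | ⟨f, hf, hf'⟩)
    · refine ⟨Fin.lastCases (Fin.natAdd a 0) fun t => Fin.castAdd _ (f t), ?_, ?_⟩
      · intro s t hst
        induction s using Fin.lastCases with
        | last => exact absurd (Fin.le_last t) (not_le.2 hst)
        | cast s =>
          induction t using Fin.lastCases with
          | last => simp [Fin.lt_def]
          | cast t =>
            have := hf (Fin.castSucc_lt_castSucc_iff.1 hst)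
            simp only [Fin.lastCases_castSucc, Fin.lt_def, Fin.val_castAdd] at this ⊢
            exact this
      · intro s t hst
        induction s using Fin.lastCases with
        | last => exact absurd (Fin.le_last t) (not_le.2 hst)
        | cast s =>
          induction t using Fin.lastCases with
          | last =>
            simp only [Fin.lastCases_last, Fin.lastCases_castSucc, Fin.lt_def, glue_left, glue_mid]
            omega
          | cast t =>
            have := hf' (Fin.castSucc_lt_castSucc_iff.1 hst)
            simp only [Fin.lastCases_castSucc, Fin.lt_def, glue_left] at this ⊢
            omega
    · refine ⟨fun t => Fin.natAdd a (f t).succ, fun s t hst => ?_, fun s t hst => ?_⟩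
      · have := hf hst
        simp only [Fin.lt_def, Fin.val_natAdd, Fin.val_succ] at this ⊢
        omega
      · have := hf' hst
        simp only [Fin.lt_def, glue_right] at this ⊢
        omega

theorem avoids_glue_iff (m : ℕ) :
    Avoids (glue σ τ) {pattern312, decreasing (m + 1)} ↔
      Avoids σ {pattern312, decreasing m} ∧ Avoids τ {pattern312, decreasing (m + 1)} := by
  simp only [avoids_pair_iff, contains_pattern312_glue, contains_decreasing_glue]
  tauto

theorem exists_eq_glue (π : Equiv.Perm (Fin (a + (b + 1)))) (hπ : ¬ Contains π pattern312)
    (h0 : (π (Fin.natAdd a 0) : ℕ) = 0) :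
    ∃ (σ : Equiv.Perm (Fin a)) (τ : Equiv.Perm (Fin b)), glue σ τ = π := by
  set M : Fin (a + (b + 1)) := Fin.natAdd a 0 with hM
  have hMa : (M : ℕ) = a := by simp [hM]
  have pos : ∀ p, p ≠ M → 0 < (π p : ℕ) := by
    intro p hp
    by_contra h
    exact hp (π.injective (Fin.ext (by omega)))
  -- Otherwise the positions `p`, `M`, `s` would carry a `312`.
  have sep : ∀ p s, p < M → M < s → π p < π s := by
    intro p s hp hs
    by_contra h
    have hne : π s ≠ π p := fun h => (hp.trans hs).ne' (π.injective h)
    refine hπ ((contains_pattern312_iff π).2 ⟨p, M, s, hp, hs, ?_,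
      lt_of_le_of_ne (not_lt.1 h) hne⟩)
    rw [Fin.lt_def, h0]
    exact pos s hs.ne'
  have left_le : ∀ p, p < M → (π p : ℕ) ≤ a := by
    intro p hp
    -- The `b` positions after `M` inject into the values above `π p`.
    have := Finset.card_le_card_of_injOn (s := Finset.Ioi M) (t := Finset.Ioi (π p)) π
      (fun s hs => by simpa using sep p s hp (by simpa using hs)) π.injective.injOn
    rw [Fin.card_Ioi, Fin.card_Ioi, hMa] at this
    omega
  have right_ge : ∀ s, M < s → a + 1 ≤ (π s : ℕ) := by
    intro s hs
    -- The `a + 1` positions up to `M` inject into the values below `π s`.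
    have := Finset.card_le_card_of_injOn (s := Finset.Iic M) (t := Finset.Iio (π s)) π
      (fun p hp => by
        rcases (by simpa using hp : p ≤ M).lt_or_eq with hp | rfl
        · simpa using sep p s hp hs
        · simp only [Finset.coe_Iio, Set.mem_Iio, Fin.lt_def, h0]
          exact pos s hs.ne') π.injective.injOn
    rw [Fin.card_Iic, Fin.card_Iio, hMa] at this
    omega
  have ltM : ∀ l : Fin a, Fin.castAdd (b + 1) l < M := fun l => by
    rw [Fin.lt_def, hMa]
    exact l.2
  have gtM : ∀ r : Fin b, M < Fin.natAdd a r.succ := fun r => by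
    rw [Fin.lt_def, hMa, Fin.val_natAdd, Fin.val_succ]
    omega
  have posL := fun l => pos _ (ltM l).ne
  have leL := fun l => left_le _ (ltM l)
  have geR := fun r => right_ge _ (gtM r)
  let σ₀ : Fin a → Fin a := fun l => ⟨π (Fin.castAdd (b + 1) l) - 1, by
    have := posL l
    have := leL l
    omega⟩
  let τ₀ : Fin b → Fin b := fun r => ⟨π (Fin.natAdd a r.succ) - (a + 1), by
    have := geR r
    have := (π (Fin.natAdd a r.succ)).2
    omega⟩
  have hσ : Function.Injective σ₀ := by
    intro l l' h
    have h1 := congrArg Fin.val h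
    have h2 := posL l
    have h3 := posL l'
    simp only [σ₀] at h1
    exact Fin.castAdd_injective a (b + 1) (π.injective (Fin.ext (by omega)))
  have hτ : Function.Injective τ₀ := by
    intro r r' h
    have h1 := congrArg Fin.val h
    have h2 := geR r
    have h3 := geR r'
    simp only [τ₀] at h1
    exact Fin.succ_injective _ (Fin.natAdd_injective (b + 1) a (π.injective (Fin.ext (by omega))))
  refine ⟨Equiv.ofBijective σ₀ (Finite.injective_iff_bijective.1 hσ),
    Equiv.ofBijective τ₀ (Finite.injective_iff_bijective.1 hτ), ?_⟩
  ext p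
  rcases exists_position p with ⟨l, rfl⟩ | rfl | ⟨r, rfl⟩
  · have := posL l
    rw [glue_left]
    simp only [Equiv.ofBijective_apply, σ₀]
    omega
  · rw [glue_mid, h0]
  · have := geR r
    rw [glue_right]
    simp only [Equiv.ofBijective_apply, τ₀]
    omega

end Glue

/-! ### Shifted fixed points and excedances -/

/-- The contribution of the value `v` at position `p` when all values are raised by `i`. -/
noncomputable def localWeight (i v p : ℕ) : Coeffs :=
  if v + i = p then x else if p < v + i then q else 1

/-- The monomial of the fixed points and excedances of `π` with all its values raised by `i`. -/
noncomputable def weight (i : ℕ) {n : ℕ} (π : Equiv.Perm (Fin n)) : Coeffs :=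
  ∏ p, localWeight i (π p) p

theorem weight_zero {n : ℕ} (π : Equiv.Perm (Fin n)) :
    weight 0 π = x ^ fp π * q ^ exc π := by
  unfold weight fp exc
  rw [← Finset.prod_const, ← Finset.prod_const, Finset.prod_filter, Finset.prod_filter,
    ← Finset.prod_mul_distrib]
  refine Finset.prod_congr rfl fun p _ => ?_
  simp only [localWeight, add_zero, Fin.ext_iff, Fin.lt_def]
  split_ifs <;> first | simp | omega

/-- In the right block positions and values both move by `a + 1`, so comparisons are unchanged; in
the left block only values move, by one. -/
theorem weight_glue (i : ℕ) {a b : ℕ} (σ : Equiv.Perm (Fin a)) (τ : Equiv.Perm (Fin b)) :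
    weight i (glue σ τ) = weight (i + 1) σ * localWeight i 0 a * weight i τ := by
  unfold weight
  rw [Fin.prod_univ_add, Fin.prod_univ_succ, mul_assoc]
  congr 1
  · refine Finset.prod_congr rfl fun l _ => ?_
    rw [glue_left, Fin.val_castAdd]
    simp only [localWeight, show (σ l : ℕ) + 1 + i = σ l + (i + 1) by omega]
  · congr 1
    · rw [glue_mid]
      simp
    · refine Finset.prod_congr rfl fun r _ => ?_
      rw [glue_right, Fin.val_natAdd, Fin.val_succ]
      unfold localWeight
      split_ifs <;> first | rfl | omega

open Classical in
/-- The weight enumerator, with values raised by `i`, of the permutations of size `n` avoiding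
`312` and the decreasing pattern of length `m`. -/
noncomputable def weightSum (i m n : ℕ) : Coeffs :=
  ∑ π : Equiv.Perm (Fin n) with Avoids π {pattern312, decreasing m}, weight i π

theorem contains_decreasing_zero {n : ℕ} (π : Equiv.Perm (Fin n)) :
    Contains π (decreasing 0) := by
  rw [contains_decreasing_iff]
  exact ⟨Fin.elim0, fun s => s.elim0, fun s => s.elim0⟩

theorem weightSum_dec_zero (i n : ℕ) : weightSum i 0 n = 0 := by
  classical
  unfold weightSum
  rw [Finset.filter_false_of_mem, Finset.sum_empty]
  intro π _ h
  exact ((avoids_pair_iff π 0).1 h).2 (contains_decreasing_zero π)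

theorem weightSum_size_zero (i m : ℕ) : weightSum i (m + 1) 0 = 1 := by
  classical
  unfold weightSum
  rw [Finset.filter_true_of_mem]
  · rw [Fintype.sum_unique]
    simp [weight]
  · intro π _
    rw [avoids_pair_iff, contains_pattern312_iff, contains_decreasing_iff]
    exact ⟨fun ⟨p, _⟩ => p.elim0, fun ⟨f, _⟩ => (f 0).elim0⟩

open Classical in
theorem sum_weight_zero_at (i m a b : ℕ) :
    ∑ π : Equiv.Perm (Fin (a + (b + 1))) with
        Avoids π {pattern312, decreasing (m + 1)} ∧ (π (Fin.natAdd a 0) : ℕ) = 0, weight i π =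
      weightSum (i + 1) m a * localWeight i 0 a * weightSum i (m + 1) b := by
  unfold weightSum
  rw [Finset.sum_mul, Finset.sum_mul_sum, ← Finset.sum_product']
  symm
  refine Finset.sum_bij (fun s _ => glue s.1 s.2) ?_ ?_ ?_ ?_
  · rintro ⟨σ, τ⟩ h
    simp only [Finset.mem_product, Finset.mem_filter, Finset.mem_univ, true_and] at h ⊢
    exact ⟨(avoids_glue_iff σ τ m).2 h, glue_mid σ τ⟩
  · rintro ⟨σ, τ⟩ _ ⟨σ', τ'⟩ _ h
    obtain ⟨rfl, rfl⟩ := glue_injective h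
    rfl
  · intro π h
    simp only [Finset.mem_filter, Finset.mem_univ, true_and] at h
    obtain ⟨σ, τ, rfl⟩ := exists_eq_glue π ((avoids_pair_iff _ _).1 h.1).1 h.2
    refine ⟨(σ, τ), ?_, rfl⟩
    simpa using (avoids_glue_iff σ τ m).1 h.1
  · rintro ⟨σ, τ⟩ _
    exact (weight_glue i σ τ).symm

theorem apply_natAdd_zero_iff {a b : ℕ} (π : Equiv.Perm (Fin (a + (b + 1)))) :
    (π (Fin.natAdd a 0) : ℕ) = 0 ↔ ((π.symm 0 : ℕ), a + b - (π.symm 0 : ℕ)) = (a, b) := by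
  have h0 : (π (Fin.natAdd a 0) : ℕ) = 0 ↔ Fin.natAdd a (0 : Fin (b + 1)) = π.symm 0 := by
    rw [Equiv.eq_symm_apply, Fin.ext_iff]
    rfl
  rw [h0, Prod.mk.injEq, Fin.ext_iff, Fin.val_natAdd, Fin.val_zero]
  omega

theorem weightSum_succ (i m n : ℕ) :
    weightSum i (m + 1) (n + 1) = ∑ ab ∈ Finset.HasAntidiagonal.antidiagonal n,
      weightSum (i + 1) m ab.1 * localWeight i 0 ab.1 * weightSum i (m + 1) ab.2 := by
  classical
  conv_lhs => unfold weightSum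
  -- The permutations are sorted by the position `a` of the value `0`, with `b` entries after it.
  rw [← Finset.sum_fiberwise_of_maps_to
    (t := Finset.HasAntidiagonal.antidiagonal n)
    (g := fun π : Equiv.Perm (Fin (n + 1)) => ((π.symm 0 : ℕ), n - (π.symm 0 : ℕ)))
    (fun π _ => by rw [Finset.HasAntidiagonal.mem_antidiagonal]; simp only; omega)]
  refine Finset.sum_congr rfl ?_
  rintro ⟨a, b⟩ hab
  obtain rfl := Finset.HasAntidiagonal.mem_antidiagonal.1 hab
  rw [← sum_weight_zero_at, Finset.filter_filter]
  refine Finset.sum_congr (Finset.filter_congr fun π _ => and_congr_right fun _ => ?_)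
    fun _ _ => rfl
  exact (apply_natAdd_zero_iff (a := a) (b := b) π).symm

theorem weightSum_of_le (h : ℕ) (n : ℕ) :
    ∀ i, n ≤ i → weightSum i (h + 1) n = boundedDyck n h * q ^ n := by
  induction n using Nat.strong_induction_on generalizing h with
  | _ n ih =>
    intro i hi
    rcases n with _ | n
    · simp [weightSum_size_zero, boundedDyck_zero]
    · rw [weightSum_succ]
      rcases h with _ | h
      · simp [weightSum_dec_zero, boundedDyck_succ_zero]
      · rw [boundedDyck_succ_succ, Nat.cast_sum, Finset.sum_mul]
        refine Finset.sum_congr rfl ?_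
        rintro ⟨a, b⟩ hab
        have hab := Finset.HasAntidiagonal.mem_antidiagonal.1 hab
        simp only at hab ⊢
        -- Here `a ≤ n < i`, so the raised `0` is itself an excedance and supplies the extra factor
        -- `q`.
        rw [ih a (by omega) h (i + 1) (by omega), ih b (by omega) (h + 1) i (by omega),
          localWeight, if_neg (by omega), if_pos (by omega), ← hab]
        push_cast
        ring

/-! ### Generating functions -/

theorem eq_oneDivOneSubZMul {B G : Coeffs⟦X⟧} (h : (1 - z * B) * G = 1) :
    G = oneDivOneSubZMul B := by
  calc G = G * ((1 - z * B) * oneDivOneSubZMul B) := by rw [oneSubZMul_mul_oneDiv, mul_one]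
    _ = ((1 - z * B) * G) * oneDivOneSubZMul B := by ring
    _ = oneDivOneSubZMul B := by rw [h, one_mul]

theorem mk_weightSum_eq (i m : ℕ) :
    PowerSeries.mk (weightSum i (m + 1)) =
      oneDivOneSubZMul (PowerSeries.mk fun a => weightSum (i + 1) m a * localWeight i 0 a) := by
  apply eq_oneDivOneSubZMul
  rw [sub_mul, one_mul, sub_eq_iff_eq_add, mul_assoc, z]
  ext1 n
  rcases n with _ | n
  · rw [map_add, coeff_zero_X_mul]
    simp [weightSum_size_zero]
  · rw [map_add, coeff_succ_X_mul, coeff_mk, coeff_mul, weightSum_succ]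
    simp [coeff_one]

theorem coeff_truncDyck (i h n : ℕ) :
    coeff n (truncDyck i h (C q * z)) = if n < i then boundedDyck n h * q ^ n else 0 := by
  have hterm : ∀ j, (boundedDyck j h : Coeffs⟦X⟧) * (C q * z) ^ j =
      C ((boundedDyck j h : Coeffs) * q ^ j) * X ^ j := by
    intro j
    rw [z, map_mul, map_natCast, map_pow, mul_pow, mul_assoc]
  simp only [truncDyck, hterm, map_sum, coeff_C_mul_X_pow, Finset.sum_ite_eq, Finset.mem_range]

/-- Coefficientwise, `x = (x - 1) + 1` at `n = i` and `q = (q - 1) + 1` for `n < i`;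
`weightSum_of_le` evaluates exactly these coefficients. -/
theorem bracket_eq (i h : ℕ) :
    (C x - 1) * (boundedDyck i h : Coeffs⟦X⟧) * C q ^ i * z ^ i
        + (C q - 1) * truncDyck i h (C q * z) + PowerSeries.mk (weightSum (i + 1) (h + 1)) =
      PowerSeries.mk fun a => weightSum (i + 1) (h + 1) a * localWeight i 0 a := by
  have h1 : (C x - 1) * (boundedDyck i h : Coeffs⟦X⟧) * C q ^ i * z ^ i =
      C ((x - 1) * boundedDyck i h * q ^ i) * X ^ i := by
    rw [z]
    simp only [map_mul, map_sub, map_natCast, map_pow, map_one]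
  have h2 : (C q - 1 : Coeffs⟦X⟧) = C (q - 1) := by
    rw [map_sub, map_one]
  rw [h1, h2]
  ext1 n
  rw [map_add, map_add, coeff_C_mul_X_pow, coeff_C_mul, coeff_truncDyck, coeff_mk, coeff_mk,
    localWeight, zero_add]
  rcases lt_trichotomy n i with hn | rfl | hn
  · rw [if_neg hn.ne, if_pos hn, if_neg hn.ne', if_pos hn,
      weightSum_of_le h n (i + 1) (by omega)]
    ring
  · rw [if_pos rfl, if_neg (lt_irrefl _), if_pos rfl, weightSum_of_le h n (n + 1) (by omega)]
    ring
  · rw [if_neg hn.ne', if_neg hn.not_gt, if_neg hn.ne, if_neg hn.not_gt]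
    ring

/-- With `k = i + h`, passing from `A_i^k` to `A_{i+1}^k` lowers `h` and raises `i`, hence induction
on `h` for all `i`. At `h = 0` only the empty permutation avoids the pattern of length one, so the
series is `1`. -/
theorem A_eq_mk_weightSum (h : ℕ) :
    ∀ i, A (i + h) i = PowerSeries.mk (weightSum i (h + 1)) := by
  induction h with
  | zero =>
    intro i
    rw [A, if_neg (by omega)]
    ext1 n
    rcases n with _ | n
    · simp [weightSum_size_zero]
    · simp [weightSum_succ, weightSum_dec_zero, coeff_one]
  | succ h ih =>
    intro i
    rw [A, if_pos (by omega), show i + (h + 1) - i - 1 = h by omega,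
      show i + (h + 1) = i + 1 + h by omega, ih, bracket_eq, mk_weightSum_eq]

end PatternFPExc

theorem mainTheorem6 (k : ℕ) :
    PatternFPExc.F {PatternFPExc.pattern312, PatternFPExc.decreasing (k + 1)} =
      PatternFPExc.A k 0 := by
  have h := PatternFPExc.A_eq_mk_weightSum k 0
  rw [Nat.zero_add] at h
  rw [h]
  ext1 n
  simp only [PatternFPExc.F, PowerSeries.coeff_mk, PatternFPExc.weightSum,
    PatternFPExc.weight_zero]
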